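/- Let $(\Omega,\mu)$ be a probability space, let $n\ge 1$, and let $\varphi_1,\dots,\varphi_n:\Omega\to\mathbb R$ be measurable functions with $\|\varphi_j\|_{L^\infty(\mu)}\le 1$ for all $j$ and $\int\varphi_i\varphi_j\,d\mu=0$ for $i\ne j$. For $1\le m\le n$ put $$\mathcal P_m=\Big\{\sum_{j\in A}a_j\varphi_j:\ A\subset\{1,\dots,n\},\ |A|=m,\ a\in\mathbb R^n,\ \Big(\sum_{j=1}^n a_j^2\Big)^{1/2}\le 1\Big\},$$ and for $t>0$ and an exponent $q$ let $N_q(\mathcal P_m,t)$ be the least number of closed $L^q(\mu)$-balls of radius $t$, with centres in the linear span of $\varphi_1,\dots,\varphi_n$ (not necessarily in $\mathcal P_m$), that cover $\mathcal P_m$. (a) For every $2\le q<\infty$ there are $\nu>2$ and $C>0$, depending only on $q$, such that for all such $(\Omega,\mu)$, $n$, $\varphi_1,\dots,\varphi_n$ and all $1\le m\le n$ the number $N_q(\mathcal P_m,t)$ is finite for every $t>0$ and $$\log N_q(\mathcal P_m,t)\le C\,m\,t^{-\nu}\log\Big(1+\frac nm\Big)\qquad(t\ge 8),$$ $$\log N_q(\mathcal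 P_m,t)\le C\,m\,\log\Big(1+\frac1t\Big)\log\Big(1+\frac nm\Big)\qquad(0<t<8).$$ (b) For every $2\le r<\infty$ there is $C>0$, depending only on $r$, such that for all such $(\Omega,\mu)$, $n$, $\varphi_1,\dots,\varphi_n$ and all $1\le m\le n$, $$\log N_r(\mathcal P_m,t)\le C\,m\,t^{-2}(\log t)\log\Big(1+\frac nm\Big)\qquad(t>2).$$ -/

import Mathlib

open MeasureTheory
open scoped ENNReal

universe u

/-- A `1`-bounded orthogonal system of real-valued functions `φ₁, …, φₙ` on `(Ω, μ)`:
the functions are measurable up to null sets, satisfy `‖φⱼ‖_{L^∞} ≤ 1`, and are mutually orthogonal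
in `L²(μ)`. -/
structure IsBoundedOrthogonalSystem {Ω : Type*} [MeasurableSpace Ω] (μ : Measure Ω) {n : ℕ}
    (φ : Fin n → Ω → ℝ) : Prop where
  aestronglyMeasurable : ∀ j, AEStronglyMeasurable (φ j) μ
  bounded : ∀ j, eLpNorm (φ j) ∞ μ ≤ 1
  orthogonal : ∀ i j, i ≠ j → ∫ u, φ i u * φ j u ∂μ = 0

/-- The set `𝒫ₘ` of all functions `∑_{j ∈ A} aⱼ φⱼ` with `A` a set of exactly `m` indices and
`a ∈ ℝⁿ` a vector of Euclidean norm at most `1`. -/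
def sparseUnitSums {Ω : Type*} {n : ℕ} (φ : Fin n → Ω → ℝ) (m : ℕ) : Set (Ω → ℝ) :=
  {f | ∃ A : Finset (Fin n), A.card = m ∧ ∃ a : EuclideanSpace ℝ (Fin n), ‖a‖ ≤ 1 ∧
    f = ∑ j ∈ A, a j • φ j}

/-- The entropy number of `U` in the `L^q(μ)` norm, inside the linear span of `φ₁, …, φₙ`: the
least number of closed `L^q` balls of radius `t`, with centres in the linear span of the `φⱼ`,
that are needed to cover `U` (`⊤` if no finite number suffices). The centres need not be in `U`. -/
noncomputable def entropyNumber {Ω : Type*} [MeasurableSpace Ω] (μ : Measure Ω) {n : ℕ}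
    (φ : Fin n → Ω → ℝ) (q : ℝ≥0∞) (U : Set (Ω → ℝ)) (t : ℝ) : ℕ∞ :=
  ⨅ (c : Finset (Ω → ℝ))
    (_ : (c : Set (Ω → ℝ)) ⊆ (Submodule.span ℝ (Set.range φ) : Submodule ℝ (Ω → ℝ)) ∧
      ∀ f ∈ U, ∃ g ∈ c, eLpNorm (f - g) q μ ≤ ENNReal.ofReal t),
    (c.card : ℕ∞)

/-!
Everything is done in `L^{2p}` for an integer `p`; other exponents follow because `L^q` norms on a
probability space increase with `q`.

*Moderate and large radii.* A sparse sum of Euclidean norm at most `1` has coefficients of `ℓ¹` norm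
at most `√m`, so `𝒫ₘ` lies in `√m` times the convex hull of the functions `±φⱼ`. Maurey's empirical
method applies: write `f / √m` as the mean of a random signed function and average `k` independent
samples. At each point the deviations are centred and bounded by `2`, so Hoeffding's lemma bounds
the `2p`-th moment of their sum by `momentConst p * k ^ p`
(`sum_prod_mul_pow_le`, `exists_sample_integral_pow_le`). Hence `k` of order `m / t²` samples give
accuracy `t`. The averages are indexed by multisets of size `k` among `2n` functions, so there are
at most `(e (2n + k) / k) ^ k` of them, which is the bound `m t⁻² log t log (1 + n / m)`
(`hasCover_of_two_lt`).

*Exponent beyond 2.* By orthogonality `𝒫ₘ` has diameter at most `2` in `L²`. Interpolating between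
`L²` and `L^{4p-2}` turns a cover of radius `T` in `L^{4p-2}` into a cover of radius of order
`T ^ ((2p-1)/(2p))` in `L^{2p}` with the same number of balls (`HasCover.of_interpolation`). This
is a power gain in the radius, part of which absorbs the logarithm (`hasCover_of_eight_le`).

*Small radii.* Start from the cover of radius `8`. For each of the `n.choose m` supports `A`,
recentre the balls in the span of `φⱼ`, `j ∈ A`. Inside this space of dimension at most `m` a ball
is covered by `5 ^ m` balls of half the radius, and about `log (16 / t)` halvings reach the radius
`t` (`HasCover.refine_by_halving`, `hasCover_of_lt_eight`).
-/

/-! ### Moments of sums of independent samples -/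

/-- Hoeffding's lemma for a finitely supported centred law with values in `[-2, 2]`. -/
theorem sum_mul_exp_le_of_centered {ι : Type*} [Fintype ι] {w y : ι → ℝ} (hw : ∀ i, 0 ≤ w i)
    (hw1 : ∑ i, w i = 1) (hy : ∀ i, |y i| ≤ 2) (hmean : ∑ i, w i * y i = 0) (s : ℝ) :
    ∑ i, w i * Real.exp (s * y i) ≤ Real.exp (2 * s ^ 2) := by
  have hpt : ∀ i, Real.exp (s * y i) ≤ Real.cosh (2 * s) + y i / 2 * Real.sinh (2 * s) := by
    intro i
    have h : |y i / 2| ≤ 1 := by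
      rw [abs_div, abs_two]
      linarith [hy i]
    have := Real.exp_mul_le_cosh_add_mul_sinh h (2 * s)
    convert this using 2
    ring
  calc ∑ i, w i * Real.exp (s * y i)
      ≤ ∑ i, w i * (Real.cosh (2 * s) + y i / 2 * Real.sinh (2 * s)) :=
        Finset.sum_le_sum fun i _ => mul_le_mul_of_nonneg_left (hpt i) (hw i)
    _ = (∑ i, w i) * Real.cosh (2 * s) + (∑ i, w i * y i) * (Real.sinh (2 * s) / 2) := by
        rw [Finset.sum_mul, Finset.sum_mul, ← Finset.sum_add_distrib]
        exact Finset.sum_congr rfl fun i _ => by ring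
    _ = Real.cosh (2 * s) := by rw [hw1, hmean]; ring
    _ ≤ Real.exp ((2 * s) ^ 2 / 2) := Real.cosh_le_exp_half_sq _
    _ = Real.exp (2 * s ^ 2) := by ring_nf

theorem sum_prod_mul_exp_sum {ι : Type*} [Fintype ι] (w y : ι → ℝ) (k : ℕ) (s : ℝ) :
    ∑ σ : Fin k → ι, (∏ i, w (σ i)) * Real.exp (s * ∑ i, y (σ i)) =
      (∑ i, w i * Real.exp (s * y i)) ^ k := by
  rw [Fintype.sum_pow]
  refine Finset.sum_congr rfl fun σ _ => ?_
  rw [Finset.prod_mul_distrib, Finset.mul_sum, Real.exp_sum]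

theorem sum_prod_eq_one {ι : Type*} [Fintype ι] {w : ι → ℝ} (hw1 : ∑ i, w i = 1) (k : ℕ) :
    ∑ σ : Fin k → ι, ∏ i, w (σ i) = 1 := by
  rw [← Fintype.sum_pow, hw1, one_pow]

theorem pow_two_mul_le_factorial_mul_exp_add_exp_neg (x : ℝ) (p : ℕ) :
    x ^ (2 * p) ≤ (2 * p).factorial * (Real.exp x + Real.exp (-x)) := by
  have h := Real.pow_div_factorial_le_exp |x| (abs_nonneg x) (2 * p)
  have hf : (0 : ℝ) < (2 * p).factorial := by positivity
  rw [div_le_iff₀ hf] at h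
  have habs : |x| ^ (2 * p) = x ^ (2 * p) := (even_two_mul p).pow_abs x
  have hexp : Real.exp |x| ≤ Real.exp x + Real.exp (-x) := by
    rcases abs_cases x with ⟨h, _⟩ | ⟨h, _⟩ <;> rw [h] <;>
      linarith [Real.exp_pos x, Real.exp_pos (-x)]
  rw [← habs]
  nlinarith

/-- The constant in the moment inequality of order `2 * p`. -/
noncomputable def momentConst (p : ℕ) : ℝ := (2 * p).factorial * (2 * Real.exp 2)

theorem one_le_momentConst (p : ℕ) : 1 ≤ momentConst p := by
  have h1 : (1 : ℝ) ≤ (2 * p).factorial := by exact_mod_cast Nat.factorial_pos _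
  have h2 : (1 : ℝ) ≤ 2 * Real.exp 2 := by linarith [Real.add_one_le_exp (2 : ℝ)]
  exact one_le_mul_of_one_le_of_one_le h1 h2

/-- Khintchine-type inequality: the `2p`-th moment of a sum of `k` independent centred samples
bounded by `2` is at most `momentConst p * k ^ p`. The expectation is over the product law on
`Fin k → ι`. -/
theorem sum_prod_mul_pow_le {ι : Type*} [Fintype ι] {w y : ι → ℝ} (hw : ∀ i, 0 ≤ w i)
    (hw1 : ∑ i, w i = 1) (hy : ∀ i, |y i| ≤ 2) (hmean : ∑ i, w i * y i = 0) {k : ℕ}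
    (hk : 1 ≤ k) (p : ℕ) :
    ∑ σ : Fin k → ι, (∏ i, w (σ i)) * (∑ i, y (σ i)) ^ (2 * p) ≤ momentConst p * (k : ℝ) ^ p := by
  have hk0 : (0 : ℝ) < k := by exact_mod_cast hk
  set s : ℝ := (Real.sqrt k)⁻¹ with hs
  have hsk : s ^ 2 * k = 1 := by
    rw [hs, inv_pow, Real.sq_sqrt hk0.le, inv_mul_cancel₀ hk0.ne']
  have hexp : ∀ r : ℝ, r ^ 2 = s ^ 2 →
      ∑ σ : Fin k → ι, (∏ i, w (σ i)) * Real.exp (r * ∑ i, y (σ i)) ≤ Real.exp 2 := by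
    intro r hr
    rw [sum_prod_mul_exp_sum]
    calc (∑ i, w i * Real.exp (r * y i)) ^ k ≤ Real.exp (2 * r ^ 2) ^ k :=
          pow_le_pow_left₀ (Finset.sum_nonneg fun i _ => mul_nonneg (hw i) (Real.exp_pos _).le)
            (sum_mul_exp_le_of_centered hw hw1 hy hmean r) k
      _ = Real.exp 2 := by
          rw [← Real.exp_nat_mul, hr]
          congr 1
          linear_combination 2 * hsk
  have hterm : ∀ σ : Fin k → ι, (∏ i, w (σ i)) * (∑ i, y (σ i)) ^ (2 * p) ≤
      ((2 * p).factorial * (k : ℝ) ^ p) * ((∏ i, w (σ i)) * Real.exp (s * ∑ i, y (σ i)) +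
        (∏ i, w (σ i)) * Real.exp (-s * ∑ i, y (σ i))) := by
    intro σ
    have hP : 0 ≤ ∏ i, w (σ i) := Finset.prod_nonneg fun i _ => hw _
    have h := pow_two_mul_le_factorial_mul_exp_add_exp_neg (s * ∑ i, y (σ i)) p
    have hS : (∑ i, y (σ i)) ^ (2 * p) = (k : ℝ) ^ p * (s * ∑ i, y (σ i)) ^ (2 * p) := by
      rw [mul_pow, pow_mul s, ← mul_assoc, ← mul_pow, mul_comm (k : ℝ), hsk, one_pow, one_mul]
    rw [hS, neg_mul]
    have := mul_le_mul_of_nonneg_left h (mul_nonneg hP (pow_nonneg hk0.le p))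
    linarith
  calc _ ≤ ∑ σ : Fin k → ι, ((2 * p).factorial * (k : ℝ) ^ p) *
        ((∏ i, w (σ i)) * Real.exp (s * ∑ i, y (σ i)) +
        (∏ i, w (σ i)) * Real.exp (-s * ∑ i, y (σ i))) := Finset.sum_le_sum fun σ _ => hterm σ
    _ ≤ ((2 * p).factorial * (k : ℝ) ^ p) * (Real.exp 2 + Real.exp 2) := by
        rw [← Finset.mul_sum, Finset.sum_add_distrib]
        exact mul_le_mul_of_nonneg_left (add_le_add (hexp s rfl) (hexp (-s) (neg_sq s)))
          (by positivity)
    _ = momentConst p * (k : ℝ) ^ p := by rw [momentConst]; ring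

theorem integrable_of_ae_abs_le {Ω : Type*} [MeasurableSpace Ω] {μ : Measure Ω}
    [IsFiniteMeasure μ] {f : Ω → ℝ} (hf : AEStronglyMeasurable f μ) {C : ℝ}
    (hC : ∀ᵐ u ∂μ, |f u| ≤ C) (k : ℕ) : Integrable (fun u => f u ^ k) μ := by
  refine Integrable.of_bound (hf.pow k) (C ^ k) ?_
  filter_upwards [hC] with u hu
  rw [Real.norm_eq_abs, abs_pow]
  exact pow_le_pow_left₀ (abs_nonneg _) hu k

/-- Maurey's empirical method in `L^{2p}`: a convex combination of functions bounded by `1` is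
approximated by an average of `k` of them (stated for the sum of the `k` deviations). -/
theorem exists_sample_integral_pow_le {Ω : Type*} [MeasurableSpace Ω] {μ : Measure Ω}
    [IsProbabilityMeasure μ] {ι : Type*} [Fintype ι] {w : ι → ℝ} (hw : ∀ i, 0 ≤ w i)
    (hw1 : ∑ i, w i = 1) {ψ : ι → Ω → ℝ} (hψ : ∀ i, AEStronglyMeasurable (ψ i) μ)
    (hψ1 : ∀ i, ∀ᵐ u ∂μ, |ψ i u| ≤ 1) {f : Ω → ℝ} (hf : ∀ u, f u = ∑ i, w i * ψ i u) {k : ℕ}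
    (hk : 1 ≤ k) (p : ℕ) :
    ∃ σ : Fin k → ι,
      ∫ u, (∑ i, (ψ (σ i) u - f u)) ^ (2 * p) ∂μ ≤ momentConst p * (k : ℝ) ^ p := by
  have hall : ∀ᵐ u ∂μ, ∀ i, |ψ i u| ≤ 1 := ae_all_iff.2 hψ1
  have hfm : AEStronglyMeasurable f μ := by
    have : f = fun u => ∑ i, w i * ψ i u := funext hf
    rw [this]
    exact Finset.aestronglyMeasurable_fun_sum _ fun i _ => (hψ i).const_mul (w i)
  have hf1 : ∀ u, (∀ i, |ψ i u| ≤ 1) → |f u| ≤ 1 := by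
    intro u hu
    rw [hf u, ← hw1]
    refine (Finset.abs_sum_le_sum_abs _ _).trans (Finset.sum_le_sum fun i _ => ?_)
    rw [abs_mul, abs_of_nonneg (hw i)]
    exact mul_le_of_le_one_right (hw i) (hu i)
  have hdev : ∀ u, (∀ i, |ψ i u| ≤ 1) → ∀ i, |ψ i u - f u| ≤ 2 := fun u hu i =>
    (abs_sub _ _).trans (by linarith [hu i, hf1 u hu])
  have hint : ∀ σ : Fin k → ι,
      Integrable (fun u => (∑ i, (ψ (σ i) u - f u)) ^ (2 * p)) μ := by
    intro σ
    refine integrable_of_ae_abs_le (C := ∑ _i : Fin k, 2)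
      (Finset.aestronglyMeasurable_fun_sum _ fun i _ => (hψ (σ i)).sub hfm) ?_ _
    filter_upwards [hall] with u hu
    exact (Finset.abs_sum_le_sum_abs _ _).trans (Finset.sum_le_sum fun i _ => hdev u hu _)
  have havg : ∑ σ : Fin k → ι, (∏ i, w (σ i)) *
      ∫ u, (∑ i, (ψ (σ i) u - f u)) ^ (2 * p) ∂μ ≤ momentConst p * (k : ℝ) ^ p := by
    have : ∑ σ : Fin k → ι, (∏ i, w (σ i)) * ∫ u, (∑ i, (ψ (σ i) u - f u)) ^ (2 * p) ∂μ =
        ∫ u, ∑ σ : Fin k → ι, (∏ i, w (σ i)) * (∑ i, (ψ (σ i) u - f u)) ^ (2 * p) ∂μ := by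
      rw [integral_finsetSum _ fun σ _ => (hint σ).const_mul _]
      exact Finset.sum_congr rfl fun σ _ => (integral_const_mul _ _).symm
    rw [this]
    calc _ ≤ ∫ _u, momentConst p * (k : ℝ) ^ p ∂μ := by
          refine integral_mono_ae (integrable_finsetSum _ fun σ _ => (hint σ).const_mul _)
            (integrable_const _) ?_
          filter_upwards [hall] with u hu
          refine sum_prod_mul_pow_le (y := fun i => ψ i u - f u) hw hw1 (hdev u hu) ?_ hk p
          simp only [mul_sub, Finset.sum_sub_distrib, ← Finset.sum_mul, hw1, ← hf u]
          ring
      _ = _ := by simp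
  have hne : (Finset.univ : Finset (Fin k → ι)).Nonempty := by
    by_contra h
    have := sum_prod_eq_one hw1 k
    rw [Finset.not_nonempty_iff_eq_empty.1 h] at this
    simp at this
  obtain ⟨σ, -, hσ⟩ := Finset.exists_min_image Finset.univ
    (fun σ : Fin k → ι => ∫ u, (∑ i, (ψ (σ i) u - f u)) ^ (2 * p) ∂μ) hne
  refine ⟨σ, le_trans ?_ havg⟩
  rw [← one_mul (∫ u, _ ∂μ), ← sum_prod_eq_one hw1 k, Finset.sum_mul]
  exact Finset.sum_le_sum fun τ hτ =>
    mul_le_mul_of_nonneg_left (hσ τ hτ) (Finset.prod_nonneg fun i _ => hw _)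

/-! ### Norms of functions in the span of the system -/

theorem eLpNorm_le_ofReal_iff {Ω : Type*} [MeasurableSpace Ω] {μ : Measure Ω}
    [IsFiniteMeasure μ] {h : Ω → ℝ} (hh : AEStronglyMeasurable h μ) {C : ℝ}
    (hC : ∀ᵐ u ∂μ, |h u| ≤ C) {p : ℕ} (hp : 1 ≤ p) {t : ℝ} (ht : 0 ≤ t) :
    eLpNorm h ((2 * p : ℕ) : ℝ≥0∞) μ ≤ ENNReal.ofReal t ↔ ∫ u, h u ^ (2 * p) ∂μ ≤ t ^ (2 * p) := by
  have hmem : MemLp h ((2 * p : ℕ) : ℝ≥0∞) μ := MemLp.of_bound hh C hC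
  have hp0 : ((2 * p : ℕ) : ℝ≥0∞) ≠ 0 := by
    simp only [ne_eq, Nat.cast_eq_zero]
    omega
  rw [hmem.eLpNorm_eq_integral_rpow_norm hp0 (ENNReal.natCast_ne_top _),
    ENNReal.ofReal_le_ofReal_iff ht, ENNReal.toReal_natCast]
  have hI : ∫ u, ‖h u‖ ^ ((2 * p : ℕ) : ℝ) ∂μ = ∫ u, h u ^ (2 * p) ∂μ := by
    refine integral_congr_ae (Filter.Eventually.of_forall fun u => ?_)
    simp only [Real.rpow_natCast, Real.norm_eq_abs]
    exact (even_two_mul p).pow_abs _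
  have hI0 : 0 ≤ ∫ u, h u ^ (2 * p) ∂μ :=
    integral_nonneg fun u => (even_two_mul p).pow_nonneg _
  have hpos : (0 : ℝ) < ((2 * p : ℕ) : ℝ) := by
    have : 0 < 2 * p := by omega
    exact_mod_cast this
  rw [hI, Real.rpow_inv_le_iff_of_pos hI0 ht hpos, Real.rpow_natCast]

namespace IsBoundedOrthogonalSystem

variable {Ω : Type*} [MeasurableSpace Ω] {μ : Measure Ω} {n : ℕ} {φ : Fin n → Ω → ℝ}

theorem ae_abs_le_one (hφ : IsBoundedOrthogonalSystem μ φ) : ∀ᵐ u ∂μ, ∀ j, |φ j u| ≤ 1 := by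
  refine ae_all_iff.2 fun j => ?_
  have h := hφ.bounded j
  rw [eLpNorm_exponent_top] at h
  filter_upwards [ae_le_eLpNormEssSup (f := φ j) (μ := μ)] with u hu
  have h1 : ‖φ j u‖ₑ ≤ 1 := hu.trans h
  rwa [← ofReal_norm, ENNReal.ofReal_le_one, Real.norm_eq_abs] at h1

theorem aestronglyMeasurable_sum (hφ : IsBoundedOrthogonalSystem μ φ) (b : Fin n → ℝ) :
    AEStronglyMeasurable (∑ j, b j • φ j) μ :=
  Finset.aestronglyMeasurable_sum _ fun j _ => (hφ.aestronglyMeasurable j).const_smul (b j)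

theorem ae_abs_sum_le (hφ : IsBoundedOrthogonalSystem μ φ) (b : Fin n → ℝ) :
    ∀ᵐ u ∂μ, |(∑ j, b j • φ j) u| ≤ ∑ j, |b j| := by
  filter_upwards [hφ.ae_abs_le_one] with u hu
  rw [Finset.sum_apply]
  refine (Finset.abs_sum_le_sum_abs _ _).trans (Finset.sum_le_sum fun j _ => ?_)
  rw [Pi.smul_apply, smul_eq_mul, abs_mul]
  exact mul_le_of_le_one_right (abs_nonneg _) (hu j)

theorem aestronglyMeasurable_of_mem_span (hφ : IsBoundedOrthogonalSystem μ φ) {f : Ω → ℝ}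
    (hf : f ∈ Submodule.span ℝ (Set.range φ)) : AEStronglyMeasurable f μ := by
  obtain ⟨b, rfl⟩ := (Submodule.mem_span_range_iff_exists_fun ℝ).1 hf
  exact hφ.aestronglyMeasurable_sum b

theorem exists_ae_abs_le_of_mem_span (hφ : IsBoundedOrthogonalSystem μ φ) {f : Ω → ℝ}
    (hf : f ∈ Submodule.span ℝ (Set.range φ)) : ∃ C, ∀ᵐ u ∂μ, |f u| ≤ C := by
  obtain ⟨b, rfl⟩ := (Submodule.mem_span_range_iff_exists_fun ℝ).1 hf
  exact ⟨_, hφ.ae_abs_sum_le b⟩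

theorem integral_sum_sq_le [IsProbabilityMeasure μ] (hφ : IsBoundedOrthogonalSystem μ φ)
    (b : Fin n → ℝ) : ∫ u, (∑ j, b j • φ j) u ^ 2 ∂μ ≤ ∑ j, b j ^ 2 := by
  have hint : ∀ i j, Integrable (fun u => φ i u * φ j u) μ := by
    intro i j
    refine Integrable.of_bound ((hφ.aestronglyMeasurable i).mul (hφ.aestronglyMeasurable j)) 1 ?_
    filter_upwards [hφ.ae_abs_le_one] with u hu
    rw [norm_mul]
    exact mul_le_one₀ (hu i) (norm_nonneg _) (hu j)
  have hdiag : ∀ i, ∫ u, φ i u * φ i u ∂μ ≤ 1 := by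
    intro i
    have : ∫ u, φ i u * φ i u ∂μ ≤ ∫ _u, (1 : ℝ) ∂μ := by
      refine integral_mono_ae (hint i i) (integrable_const _) ?_
      filter_upwards [hφ.ae_abs_le_one] with u hu
      have := hu i
      have h2 := abs_mul_abs_self (φ i u)
      nlinarith [abs_nonneg (φ i u)]
    simpa using this
  have hexp : ∀ u, (∑ j, b j • φ j) u ^ 2 = ∑ i, ∑ j, (b i * b j) * (φ i u * φ j u) := by
    intro u
    rw [Finset.sum_apply, sq, Finset.sum_mul_sum]
    refine Finset.sum_congr rfl fun i _ => Finset.sum_congr rfl fun j _ => ?_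
    simp only [Pi.smul_apply, smul_eq_mul]
    ring
  simp only [hexp]
  rw [integral_finsetSum _ fun i _ => integrable_finsetSum _ fun j _ => (hint i j).const_mul _]
  refine Finset.sum_le_sum fun i _ => ?_
  rw [integral_finsetSum _ fun j _ => (hint i j).const_mul _, Finset.sum_eq_single i]
  · rw [integral_const_mul]
    nlinarith [hdiag i, mul_self_nonneg (b i)]
  · intro j _ hji
    rw [integral_const_mul, hφ.orthogonal i j hji.symm, mul_zero]
  · simp

end IsBoundedOrthogonalSystem

/-! ### Coefficients of sparse sums -/

theorem mem_sparseUnitSums_iff {Ω : Type*} {n : ℕ} {φ : Fin n → Ω → ℝ} {m : ℕ} {f : Ω → ℝ} :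
    f ∈ sparseUnitSums φ m ↔ ∃ A : Finset (Fin n), A.card = m ∧ ∃ b : Fin n → ℝ,
      (∀ j ∉ A, b j = 0) ∧ ∑ j, b j ^ 2 ≤ 1 ∧ f = ∑ j, b j • φ j := by
  constructor
  · rintro ⟨A, hA, a, ha, rfl⟩
    refine ⟨A, hA, fun j => if j ∈ A then a j else 0, fun j hj => if_neg hj, ?_, ?_⟩
    · have h1 : ∑ j, a j ^ 2 ≤ 1 := by
        rw [← EuclideanSpace.real_norm_sq_eq]
        exact pow_le_one₀ (norm_nonneg _) ha
      refine le_trans (Finset.sum_le_sum fun j _ => ?_) h1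
      by_cases hj : j ∈ A <;> simp [hj, sq_nonneg]
    · simp [Finset.sum_ite_mem]
  · rintro ⟨A, hA, b, hb, hb1, rfl⟩
    refine ⟨A, hA, WithLp.toLp 2 b, ?_, ?_⟩
    · rw [← abs_of_nonneg (norm_nonneg (WithLp.toLp 2 b)), ← sq_le_one_iff_abs_le_one,
        EuclideanSpace.real_norm_sq_eq]
      exact hb1
    · refine (Finset.sum_subset (Finset.subset_univ A) fun j _ hj => ?_).symm
      simp [hb j hj]

theorem sum_abs_le_sqrt_of_sparse {n m : ℕ} {A : Finset (Fin n)} (hA : A.card = m)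
    {b : Fin n → ℝ} (hb : ∀ j ∉ A, b j = 0) (hb1 : ∑ j, b j ^ 2 ≤ 1) :
    ∑ j, |b j| ≤ Real.sqrt m := by
  have h0 : ∑ j, |b j| = ∑ j ∈ A, |b j| :=
    (Finset.sum_subset (Finset.subset_univ A) fun j _ hj => by simp [hb j hj]).symm
  rw [h0]
  refine Real.le_sqrt_of_sq_le ?_
  have h1 := sq_sum_le_card_mul_sum_sq (s := A) (f := fun j => |b j|)
  have h2 : ∑ j ∈ A, |b j| ^ 2 ≤ 1 := by
    simp only [sq_abs]
    exact (Finset.sum_le_sum_of_subset_of_nonneg (Finset.subset_univ A)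
      fun j _ _ => sq_nonneg _).trans hb1
  rw [hA] at h1
  exact h1.trans (mul_le_of_le_one_right (Nat.cast_nonneg _) h2)

theorem sparseUnitSums_subset_span {Ω : Type*} {n : ℕ} (φ : Fin n → Ω → ℝ) (m : ℕ) :
    sparseUnitSums φ m ⊆ (Submodule.span ℝ (Set.range φ) : Submodule ℝ (Ω → ℝ)) := by
  intro f hf
  obtain ⟨A, -, b, -, -, rfl⟩ := mem_sparseUnitSums_iff.1 hf
  exact Submodule.sum_mem _ fun j _ =>
    Submodule.smul_mem _ _ (Submodule.subset_span (Set.mem_range_self j))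

/-! ### Finite covers -/

/-- `U` is covered by at most `N` closed `L^q(μ)` balls of radius `t` with centres in the span of
the `φⱼ`. The bound `N` is real, so that it can be given as an exponential. -/
def HasCover {Ω : Type*} [MeasurableSpace Ω] (μ : Measure Ω) {n : ℕ} (φ : Fin n → Ω → ℝ)
    (q : ℝ≥0∞) (U : Set (Ω → ℝ)) (t N : ℝ) : Prop :=
  ∃ c : Finset (Ω → ℝ),
    (c : Set (Ω → ℝ)) ⊆ (Submodule.span ℝ (Set.range φ) : Submodule ℝ (Ω → ℝ)) ∧
    (∀ f ∈ U, ∃ g ∈ c, eLpNorm (f - g) q μ ≤ ENNReal.ofReal t) ∧ (c.card : ℝ) ≤ N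

namespace HasCover

variable {Ω : Type*} [MeasurableSpace Ω] {μ : Measure Ω} {n : ℕ} {φ : Fin n → Ω → ℝ}
  {q : ℝ≥0∞} {U : Set (Ω → ℝ)} {t N : ℝ}

theorem entropyNumber_ne_top_and_log_le {x : ℝ} (h : HasCover μ φ q U t (Real.exp x))
    (hx : 0 ≤ x) : entropyNumber μ φ q U t ≠ ⊤ ∧
      Real.log ((entropyNumber μ φ q U t).toNat : ℝ) ≤ x := by
  obtain ⟨c, hcs, hc, hcard⟩ := h
  have hle : entropyNumber μ φ q U t ≤ (c.card : ℕ∞) := iInf₂_le c ⟨hcs, hc⟩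
  have htop : entropyNumber μ φ q U t ≠ ⊤ := ne_top_of_le_ne_top (ENat.natCast_ne_top _) hle
  refine ⟨htop, ?_⟩
  have hnat : (entropyNumber μ φ q U t).toNat ≤ c.card := by
    have := ENat.toNat_le_toNat hle (ENat.natCast_ne_top _)
    simpa using this
  -- `Real.log 0 = 0`: the junk value is harmless because the bound is nonnegative.
  rcases Nat.eq_zero_or_pos (entropyNumber μ φ q U t).toNat with h0 | hpos
  · simpa [h0] using hx
  · rw [Real.log_le_iff_le_exp (by exact_mod_cast hpos)]
    exact le_trans (by exact_mod_cast hnat) hcard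

theorem mono_card {N' : ℝ} (h : HasCover μ φ q U t N) (hN : N ≤ N') : HasCover μ φ q U t N' := by
  obtain ⟨c, hcs, hc, hcard⟩ := h
  exact ⟨c, hcs, hc, hcard.trans hN⟩

theorem mono_exponent [IsProbabilityMeasure μ] (hφ : IsBoundedOrthogonalSystem μ φ)
    (hU : U ⊆ (Submodule.span ℝ (Set.range φ) : Submodule ℝ (Ω → ℝ))) {q' : ℝ≥0∞} (hq : q ≤ q')
    (h : HasCover μ φ q' U t N) : HasCover μ φ q U t N := by
  obtain ⟨c, hcs, hc, hcard⟩ := h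
  refine ⟨c, hcs, fun f hf => ?_, hcard⟩
  obtain ⟨g, hg, hfg⟩ := hc f hf
  exact ⟨g, hg, (eLpNorm_le_eLpNorm_of_exponent_le hq
    (hφ.aestronglyMeasurable_of_mem_span (Submodule.sub_mem _ (hU hf) (hcs hg)))).trans hfg⟩

/-- The centres of a cover can be moved into any subset of the covered set at the cost of doubling
the radius. -/
theorem exists_centers_mem (hφ : IsBoundedOrthogonalSystem μ φ) (hq : 1 ≤ q) (ht : 0 ≤ t)
    (hU : U ⊆ (Submodule.span ℝ (Set.range φ) : Submodule ℝ (Ω → ℝ)))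
    (h : HasCover μ φ q U t N) {V : Set (Ω → ℝ)} (hV : V ⊆ U) :
    ∃ c : Finset (Ω → ℝ), (c : Set (Ω → ℝ)) ⊆ V ∧
      (∀ f ∈ V, ∃ g ∈ c, eLpNorm (f - g) q μ ≤ ENNReal.ofReal (2 * t)) ∧ (c.card : ℝ) ≤ N := by
  classical
  obtain ⟨c, hcs, hc, hcard⟩ := h
  let c' := c.filter fun g => ∃ f ∈ V, eLpNorm (f - g) q μ ≤ ENNReal.ofReal t
  have hex : ∀ g ∈ c', ∃ f ∈ V, eLpNorm (f - g) q μ ≤ ENNReal.ofReal t := fun g hg =>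
    (Finset.mem_filter.1 hg).2
  choose! F hFV hF using hex
  refine ⟨c'.image F, ?_, fun f hf => ?_, ?_⟩
  · intro f hf
    obtain ⟨g, hg, rfl⟩ := Finset.mem_image.1 hf
    exact hFV g hg
  · obtain ⟨g, hg, hfg⟩ := hc f (hV hf)
    have hg' : g ∈ c' := Finset.mem_filter.2 ⟨hg, f, hf, hfg⟩
    refine ⟨F g, Finset.mem_image_of_mem F hg', ?_⟩
    have hm : ∀ {f₁ f₂}, f₁ ∈ Submodule.span ℝ (Set.range φ) →
        f₂ ∈ Submodule.span ℝ (Set.range φ) → AEStronglyMeasurable (f₁ - f₂) μ :=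
      fun h₁ h₂ => hφ.aestronglyMeasurable_of_mem_span (Submodule.sub_mem _ h₁ h₂)
    have hsplit : f - F g = (f - g) + (g - F g) := by abel
    rw [hsplit, two_mul, ENNReal.ofReal_add ht ht]
    refine (eLpNorm_add_le (hm (hU (hV hf)) (hcs hg)) (hm (hcs hg) (hU (hV (hFV g hg')))) hq).trans
      (add_le_add hfg ?_)
    rw [eLpNorm_sub_comm]
    exact hF g hg'
  · exact le_trans (by exact_mod_cast Finset.card_image_le.trans (Finset.card_filter_le _ _)) hcard

end HasCover

/-! ### Counting -/

theorem choose_le_exp_mul_div_pow {M N k : ℕ} (hk : 1 ≤ k) (hMN : M ≤ N) :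
    (M.choose k : ℝ) ≤ (Real.exp 1 * (N / k)) ^ k := by
  have hk0 : (0 : ℝ) < k := by exact_mod_cast hk
  have hf : (0 : ℝ) < k.factorial := by positivity
  have h1 : (M.choose k : ℝ) ≤ (N : ℝ) ^ k / k.factorial :=
    (Nat.choose_le_pow_div k M).trans (by gcongr)
  have h2 := Real.pow_div_factorial_le_exp (k : ℝ) hk0.le k
  have h3 : Real.exp k = Real.exp 1 ^ k := by rw [← Real.exp_nat_mul, mul_one]
  calc (M.choose k : ℝ) ≤ (N : ℝ) ^ k / k.factorial := h1
    _ = (N / k : ℝ) ^ k * ((k : ℝ) ^ k / k.factorial) := by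
        rw [div_pow]
        field_simp
    _ ≤ (N / k : ℝ) ^ k * Real.exp 1 ^ k := by
        rw [← h3]
        exact mul_le_mul_of_nonneg_left h2 (by positivity)
    _ = (Real.exp 1 * (N / k)) ^ k := by rw [mul_pow]; ring

theorem card_sym_le_exp_mul_div_pow {ι : Type*} [Fintype ι] [DecidableEq ι] {k : ℕ} (hk : 1 ≤ k) :
    (Fintype.card (Sym ι k) : ℝ) ≤ (Real.exp 1 * ((Fintype.card ι + k : ℕ) / k)) ^ k := by
  rw [Sym.card_sym_eq_choose]
  exact choose_le_exp_mul_div_pow hk (Nat.sub_le _ _)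

/-! ### Covering by empirical averages -/

/-- Weights exhibiting a vector of `ℓ¹` norm at most `1` as a convex combination of the signed unit
vectors; the missing mass is split evenly between opposite signs. -/
theorem exists_weights_of_sum_abs_le_one {n : ℕ} (hn : 1 ≤ n) {b : Fin n → ℝ}
    (hb : ∑ j, |b j| ≤ 1) :
    ∃ w : Fin n × Bool → ℝ, (∀ i, 0 ≤ w i) ∧ ∑ i, w i = 1 ∧
      ∀ j, w (j, true) - w (j, false) = b j := by
  have hn0 : (0 : ℝ) < n := by exact_mod_cast hn
  refine ⟨fun i => (|b i.1| + cond i.2 (b i.1) (-b i.1)) / 2 + (1 - ∑ j, |b j|) / (2 * n),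
    ?_, ?_, ?_⟩
  · rintro ⟨j, s⟩
    have h1 : 0 ≤ (1 - ∑ j, |b j|) / (2 * n) := div_nonneg (by linarith) (by positivity)
    have h2 := neg_abs_le (b j)
    have h3 := le_abs_self (b j)
    cases s <;> simp only [cond_true, cond_false] <;> linarith
  · rw [Fintype.sum_prod_type]
    have : ∀ j : Fin n, ∑ s : Bool, ((|b j| + cond s (b j) (-b j)) / 2 +
        (1 - ∑ j, |b j|) / (2 * n)) = |b j| + (1 - ∑ j, |b j|) / n := by
      intro j
      rw [Fintype.sum_bool, cond_true, cond_false]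
      field_simp
      ring
    simp only [this]
    rw [Finset.sum_add_distrib, Finset.sum_const, Finset.card_univ, Fintype.card_fin, nsmul_eq_mul,
      mul_div_cancel₀ _ hn0.ne']
    ring
  · intro j
    simp only [cond_true, cond_false]
    ring

/-- Covering of the sparse sums by the averages of `k` signed functions `±√m φⱼ`. Averages are
counted as multisets, which is what makes `log (n / m)` rather than `log n` appear. -/
theorem HasCover.of_empirical {Ω : Type*} [MeasurableSpace Ω] {μ : Measure Ω}
    [IsProbabilityMeasure μ] {n m : ℕ} {φ : Fin n → Ω → ℝ} (hφ : IsBoundedOrthogonalSystem μ φ)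
    (hm : 1 ≤ m) (hmn : m ≤ n) {p k : ℕ} (hp : 1 ≤ p) (hk : 1 ≤ k) {t : ℝ} (ht : 0 < t)
    (hkt : momentConst p * m ≤ k * t ^ 2) :
    HasCover μ φ ((2 * p : ℕ) : ℝ≥0∞) (sparseUnitSums φ m) t
      ((Real.exp 1 * ((2 * n + k : ℕ) / k)) ^ k) := by
  classical
  have hk0 : (0 : ℝ) < k := by exact_mod_cast hk
  have hm0 : (0 : ℝ) < m := by exact_mod_cast hm
  set R := Real.sqrt m with hR
  have hR0 : 0 < R := Real.sqrt_pos.2 hm0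
  have hR2 : R ^ 2 = m := Real.sq_sqrt hm0.le
  let ψ : Fin n × Bool → Ω → ℝ := fun i => cond i.2 (φ i.1) (-φ i.1)
  let G : Sym (Fin n × Bool) k → Ω → ℝ := fun s => (R / k) • ((s : Multiset _).map ψ).sum
  have hspan : ∀ i, ψ i ∈ Submodule.span ℝ (Set.range φ) := by
    rintro ⟨j, s⟩
    have hj : φ j ∈ Submodule.span ℝ (Set.range φ) :=
      Submodule.subset_span (Set.mem_range_self j)
    cases s
    · exact Submodule.neg_mem _ hj
    · exact hj
  have hψ1 : ∀ i, ∀ᵐ u ∂μ, |ψ i u| ≤ 1 := by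
    rintro ⟨j, s⟩
    filter_upwards [hφ.ae_abs_le_one] with u hu
    cases s
    · simpa [ψ] using hu j
    · exact hu j
  refine ⟨Finset.univ.image G, ?_, ?_, ?_⟩
  · intro f hf
    obtain ⟨s, -, rfl⟩ := Finset.mem_image.1 hf
    refine Submodule.smul_mem _ _ (multiset_sum_mem _ fun g hg => ?_)
    obtain ⟨i, -, rfl⟩ := Multiset.mem_map.1 hg
    exact hspan i
  · intro f hf
    have hfspan := sparseUnitSums_subset_span φ m hf
    obtain ⟨A, hA, b, hbA, hb1, hfb⟩ := mem_sparseUnitSums_iff.1 hf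
    have hbR : ∑ j, |b j / R| ≤ 1 := by
      have : ∑ j, |b j / R| = (∑ j, |b j|) / R := by
        rw [Finset.sum_div]
        exact Finset.sum_congr rfl fun j _ => by rw [abs_div, abs_of_pos hR0]
      rw [this, div_le_one hR0]
      exact sum_abs_le_sqrt_of_sparse hA hbA hb1
    obtain ⟨w, hw0, hw1, hwb⟩ := exists_weights_of_sum_abs_le_one (hm.trans hmn) hbR
    have hfw : ∀ u, f u / R = ∑ i, w i * ψ i u := by
      intro u
      rw [Fintype.sum_prod_type, hfb, Finset.sum_apply, Finset.sum_div]
      refine Finset.sum_congr rfl fun j _ => ?_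
      rw [Fintype.sum_bool]
      simp only [ψ, cond_true, cond_false, Pi.smul_apply, Pi.neg_apply, smul_eq_mul]
      linear_combination (-φ j u) * hwb j
    obtain ⟨σ, hσ⟩ := exists_sample_integral_pow_le hw0 hw1
      (fun i => hφ.aestronglyMeasurable_of_mem_span (hspan i)) hψ1 hfw hk p
    let s : Sym (Fin n × Bool) k := Sym.mk (Finset.univ.val.map σ) (by simp)
    refine ⟨G s, Finset.mem_image_of_mem G (Finset.mem_univ s), ?_⟩
    have hG : G s = (R / k) • ∑ i, ψ (σ i) := by
      simp only [G, s, Sym.coe_mk, Multiset.map_map]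
      rfl
    have hGspan : G s ∈ Submodule.span ℝ (Set.range φ) := by
      rw [hG]
      exact Submodule.smul_mem _ _ (Submodule.sum_mem _ fun i _ => hspan _)
    have hsub := Submodule.sub_mem _ hfspan hGspan
    obtain ⟨C, hC⟩ := hφ.exists_ae_abs_le_of_mem_span hsub
    rw [eLpNorm_le_ofReal_iff (hφ.aestronglyMeasurable_of_mem_span hsub) hC hp ht.le]
    have hpt : ∀ u, (f - G s) u ^ (2 * p) =
        (R / k) ^ (2 * p) * (∑ i, (ψ (σ i) u - f u / R)) ^ (2 * p) := by
      intro u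
      rw [← mul_pow, ← (even_two_mul p).neg_pow]
      congr 1
      rw [hG, Finset.sum_sub_distrib, Finset.sum_const, Finset.card_univ, Fintype.card_fin,
        nsmul_eq_mul, Pi.sub_apply, Pi.smul_apply, Finset.sum_apply, smul_eq_mul]
      field_simp
      ring
    simp only [hpt]
    rw [integral_const_mul]
    have hK := one_le_momentConst p
    calc _ ≤ (R / k) ^ (2 * p) * (momentConst p * (k : ℝ) ^ p) :=
          mul_le_mul_of_nonneg_left hσ (by positivity)
      _ ≤ (R / k) ^ (2 * p) * (momentConst p ^ p * (k : ℝ) ^ p) := by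
          gcongr
          exact le_self_pow₀ hK (by omega)
      _ = (momentConst p * m / k) ^ p := by
          rw [pow_mul, ← mul_pow, ← mul_pow, div_pow, hR2]
          congr 1
          field_simp
      _ ≤ (t ^ 2) ^ p := by
          refine pow_le_pow_left₀ (by positivity) ?_ p
          rw [div_le_iff₀ hk0]
          linarith
      _ = t ^ (2 * p) := (pow_mul _ _ _).symm
  · have h := card_sym_le_exp_mul_div_pow (ι := Fin n × Bool) hk
    rw [Fintype.card_prod, Fintype.card_fin, Fintype.card_bool, mul_comm n 2] at h
    refine le_trans ?_ h
    exact_mod_cast Finset.card_image_le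

theorem log_one_add_div_ge {n m : ℕ} (hm : 1 ≤ m) (hmn : m ≤ n) :
    1 / 2 ≤ Real.log (1 + (n : ℝ) / m) := by
  have hm0 : (0 : ℝ) < m := by exact_mod_cast hm
  have h1 : (1 : ℝ) ≤ n / m := by
    rw [le_div_iff₀ hm0, one_mul]
    exact_mod_cast hmn
  have h2 : Real.log 2 ≤ Real.log (1 + (n : ℝ) / m) :=
    Real.log_le_log two_pos (by linarith)
  linarith [Real.log_two_gt_d9]

/-- The entropy bound `m t⁻² log t log (1 + n / m)` in `L^{2p}`. -/
theorem hasCover_of_two_lt {Ω : Type*} [MeasurableSpace Ω] {μ : Measure Ω}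
    [IsProbabilityMeasure μ] {n m : ℕ} {φ : Fin n → Ω → ℝ} (hφ : IsBoundedOrthogonalSystem μ φ)
    (hm : 1 ≤ m) (hmn : m ≤ n) {p : ℕ} (hp : 1 ≤ p) {t : ℝ} (ht : 2 < t) :
    HasCover μ φ ((2 * p : ℕ) : ℝ≥0∞) (sparseUnitSums φ m) t
      (Real.exp (14 * (momentConst p + 1) *
        ((m : ℝ) * t ^ (-2 : ℤ) * Real.log t * Real.log (1 + (n : ℝ) / m)))) := by
  have hm0 : (0 : ℝ) < m := by exact_mod_cast hm
  have hn0 : (0 : ℝ) < n := by exact_mod_cast hm.trans hmn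
  have ht0 : 0 < t := by linarith
  have hK := one_le_momentConst p
  have hL := log_one_add_div_ge hm hmn
  have hlt : 1 / 2 ≤ Real.log t := by
    have := Real.log_le_log two_pos ht.le
    linarith [Real.log_two_gt_d9]
  have htz : t ^ (-2 : ℤ) = (t ^ 2)⁻¹ := by
    rw [zpow_neg]
    norm_cast
  rw [htz]
  set L := Real.log (1 + (n : ℝ) / m) with hLdef
  rcases le_total (m : ℝ) (t ^ 2) with hmt | hmt
  · -- For `t ≥ √m` the whole set lies in one ball around `0`.
    refine ⟨{0}, by simp, fun f hf => ⟨0, Finset.mem_singleton_self 0, ?_⟩, ?_⟩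
    · obtain ⟨A, hA, b, hbA, hb1, rfl⟩ := mem_sparseUnitSums_iff.1 hf
      rw [sub_zero]
      have hbt : ∑ j, |b j| ≤ t :=
        (sum_abs_le_sqrt_of_sparse hA hbA hb1).trans (Real.sqrt_le_iff.2 ⟨ht0.le, hmt⟩)
      refine (eLpNorm_le_of_ae_bound (C := t) ?_).trans (by simp)
      filter_upwards [hφ.ae_abs_sum_le b] with u hu
      exact hu.trans hbt
    · rw [Finset.card_singleton, Nat.cast_one]
      have : 0 ≤ Real.log t * L := mul_nonneg (by linarith) (by linarith)
      refine Real.one_le_exp ?_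
      rw [mul_assoc (m * (t ^ 2)⁻¹)]
      positivity
  · set k := ⌈momentConst p * m / t ^ 2⌉₊ with hkdef
    have hx : 0 < momentConst p * m / t ^ 2 := by positivity
    have hk : 1 ≤ k := Nat.ceil_pos.2 hx
    have hk0 : (0 : ℝ) < k := by exact_mod_cast hk
    have hkl : momentConst p * m / t ^ 2 ≤ k := Nat.le_ceil _
    have hku : (k : ℝ) ≤ (momentConst p + 1) * (m * (t ^ 2)⁻¹) := by
      have h1 : (k : ℝ) ≤ momentConst p * m / t ^ 2 + 1 := (Nat.ceil_lt_add_one hx.le).le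
      have h2 : 1 ≤ (m : ℝ) / t ^ 2 := by rwa [le_div_iff₀ (by positivity), one_mul]
      calc (k : ℝ) ≤ momentConst p * m / t ^ 2 + m / t ^ 2 := by linarith
        _ = _ := by ring
    have hmk : (m : ℝ) ≤ k * t ^ 2 := by
      rw [div_le_iff₀ (by positivity)] at hkl
      nlinarith
    have hratio : (((2 * n + k : ℕ) : ℝ) / k) ≤ 2 * t ^ 2 * (1 + n / m) := by
      have h1 : (n : ℝ) / k ≤ t ^ 2 * (n / m) := by
        rw [div_le_iff₀ hk0]
        calc (n : ℝ) = n / m * m := by field_simp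
          _ ≤ n / m * (k * t ^ 2) := by gcongr
          _ = _ := by ring
      have h2 : (((2 * n + k : ℕ) : ℝ) / k) = 2 * (n / k) + 1 := by
        push_cast
        field_simp
      rw [h2]
      nlinarith
    refine (HasCover.of_empirical hφ hm hmn hp hk ht0 ?_).mono_card ?_
    · rwa [div_le_iff₀ (by positivity)] at hkl
    · have hlog : Real.log (Real.exp 1 * ((2 * n + k : ℕ) / k)) ≤ 14 * (Real.log t * L) := by
        have hpos : (0 : ℝ) < ((2 * n + k : ℕ) : ℝ) / k := by positivity
        have h1 : Real.log (((2 * n + k : ℕ) : ℝ) / k) ≤ Real.log 2 + 2 * Real.log t + L := by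
          refine (Real.log_le_log hpos hratio).trans_eq ?_
          rw [Real.log_mul (by positivity) (by positivity), Real.log_mul two_ne_zero (by positivity),
            Real.log_pow, Nat.cast_ofNat]
        rw [Real.log_mul (Real.exp_pos 1).ne' hpos.ne', Real.log_exp]
        have h3 := Real.log_two_lt_d9
        nlinarith [mul_nonneg (sub_nonneg.2 hlt) (sub_nonneg.2 hL)]
      calc (Real.exp 1 * ((2 * n + k : ℕ) / k)) ^ k
          = Real.exp (k * Real.log (Real.exp 1 * ((2 * n + k : ℕ) / k))) := by
            rw [Real.exp_nat_mul, Real.exp_log (by positivity)]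
        _ ≤ _ := by
            refine Real.exp_le_exp.2 ?_
            have h0 : 0 ≤ 14 * (Real.log t * L) := by
              have : 0 ≤ Real.log t * L := mul_nonneg (by linarith) (by linarith)
              linarith
            calc (k : ℝ) * Real.log (Real.exp 1 * ((2 * n + k : ℕ) / k))
                ≤ (k : ℝ) * (14 * (Real.log t * L)) := mul_le_mul_of_nonneg_left hlog hk0.le
              _ ≤ (momentConst p + 1) * (m * (t ^ 2)⁻¹) * (14 * (Real.log t * L)) :=
                  mul_le_mul_of_nonneg_right hku h0
              _ = _ := by ring

/-! ### Improved exponent by interpolation with `L²` -/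

/-- Interpolation between `L²` and `L^{4p-2}`, in the form needed for differences of elements of
the unit ball of `L²`. The exponent `2 * (2 * p - 1)` is chosen so that
`|h| ^ (2p) = |h| * |h| ^ (2p-1)` and the Cauchy–Schwarz inequality apply. -/
theorem integral_pow_two_mul_le {Ω : Type*} [MeasurableSpace Ω] {μ : Measure Ω}
    [IsProbabilityMeasure μ] {h : Ω → ℝ} (hh : AEStronglyMeasurable h μ) {C : ℝ}
    (hC : ∀ᵐ u ∂μ, |h u| ≤ C) {p : ℕ} (hp : 1 ≤ p) {S : ℝ} (hS : 0 < S)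
    (h2 : ∫ u, h u ^ 2 ∂μ ≤ 4)
    (hr : ∫ u, h u ^ (2 * (2 * p - 1)) ∂μ ≤ S ^ (2 * (2 * p - 1))) :
    ∫ u, h u ^ (2 * p) ∂μ ≤ 2 * S ^ (2 * p - 1) := by
  set N := 2 * p - 1 with hN
  have hpN : 2 * p = N + 1 := by omega
  have hSN : 0 < S ^ N := pow_pos hS N
  have hpt : ∀ u, h u ^ (2 * p) ≤
      S ^ N / 4 * h u ^ 2 + (S ^ N)⁻¹ * h u ^ (2 * N) := by
    intro u
    have hsq : 0 ≤ (S ^ N)⁻¹ * (S ^ N / 2 * h u - h u ^ N) ^ 2 := by positivity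
    have : (S ^ N)⁻¹ * (S ^ N / 2 * h u - h u ^ N) ^ 2 =
        S ^ N / 4 * h u ^ 2 + (S ^ N)⁻¹ * h u ^ (2 * N) - h u ^ (2 * p) := by
      rw [hpN]
      field_simp
      ring
    linarith
  calc ∫ u, h u ^ (2 * p) ∂μ
      ≤ ∫ u, (S ^ N / 4 * h u ^ 2 + (S ^ N)⁻¹ * h u ^ (2 * N)) ∂μ :=
        integral_mono (integrable_of_ae_abs_le hh hC _)
          (((integrable_of_ae_abs_le hh hC _).const_mul _).add
            ((integrable_of_ae_abs_le hh hC _).const_mul _)) hpt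
    _ = S ^ N / 4 * ∫ u, h u ^ 2 ∂μ + (S ^ N)⁻¹ * ∫ u, h u ^ (2 * N) ∂μ := by
        rw [integral_add ((integrable_of_ae_abs_le hh hC _).const_mul _)
          ((integrable_of_ae_abs_le hh hC _).const_mul _), integral_const_mul, integral_const_mul]
    _ ≤ S ^ N / 4 * 4 + (S ^ N)⁻¹ * S ^ (2 * N) := by gcongr
    _ = 2 * S ^ N := by
        field_simp
        ring

theorem integral_sub_sq_le_four {Ω : Type*} [MeasurableSpace Ω] {μ : Measure Ω}
    [IsProbabilityMeasure μ] {n m : ℕ} {φ : Fin n → Ω → ℝ} (hφ : IsBoundedOrthogonalSystem μ φ)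
    {f g : Ω → ℝ} (hf : f ∈ sparseUnitSums φ m) (hg : g ∈ sparseUnitSums φ m) :
    ∫ u, (f - g) u ^ 2 ∂μ ≤ 4 := by
  obtain ⟨-, -, a, -, ha, rfl⟩ := mem_sparseUnitSums_iff.1 hf
  obtain ⟨-, -, b, -, hb, rfl⟩ := mem_sparseUnitSums_iff.1 hg
  have hab : ∑ j, a j • φ j - ∑ j, b j • φ j = ∑ j, (a j - b j) • φ j := by
    rw [← Finset.sum_sub_distrib]
    exact Finset.sum_congr rfl fun j _ => (sub_smul _ _ _).symm
  rw [hab]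
  calc _ ≤ ∑ j, (a j - b j) ^ 2 := hφ.integral_sum_sq_le fun j => a j - b j
    _ ≤ ∑ j, (2 * a j ^ 2 + 2 * b j ^ 2) :=
        Finset.sum_le_sum fun j _ => by nlinarith [sq_nonneg (a j + b j)]
    _ = 2 * ∑ j, a j ^ 2 + 2 * ∑ j, b j ^ 2 := by
        rw [Finset.sum_add_distrib, Finset.mul_sum, Finset.mul_sum]
    _ ≤ 4 := by linarith

/-- A cover in `L^{4p-2}` of radius `T` becomes, after moving the centres into `𝒫ₘ`, a cover in
`L^{2p}` of radius `2 T ^ ((2p-1)/(2p))`. -/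
theorem HasCover.of_interpolation {Ω : Type*} [MeasurableSpace Ω] {μ : Measure Ω}
    [IsProbabilityMeasure μ] {n m : ℕ} {φ : Fin n → Ω → ℝ} (hφ : IsBoundedOrthogonalSystem μ φ)
    {p : ℕ} (hp : 1 ≤ p) {t T N : ℝ} (ht : 0 ≤ t) (hT : 0 < T)
    (htT : T ^ (2 * p - 1) ≤ (t / 2) ^ (2 * p))
    (h : HasCover μ φ ((2 * (2 * p - 1) : ℕ) : ℝ≥0∞) (sparseUnitSums φ m) T N) :
    HasCover μ φ ((2 * p : ℕ) : ℝ≥0∞) (sparseUnitSums φ m) t N := by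
  have hspan := sparseUnitSums_subset_span φ m
  have hq1 : (1 : ℝ≥0∞) ≤ ((2 * (2 * p - 1) : ℕ) : ℝ≥0∞) := by
    rw [Nat.one_le_cast]
    omega
  obtain ⟨c, hcs, hc, hcard⟩ := h.exists_centers_mem hφ hq1 hT.le hspan subset_rfl
  refine ⟨c, hcs.trans hspan, fun f hf => ?_, hcard⟩
  obtain ⟨g, hg, hfg⟩ := hc f hf
  refine ⟨g, hg, ?_⟩
  have hsub := Submodule.sub_mem _ (hspan hf) (hspan (hcs hg))
  have hmeas := hφ.aestronglyMeasurable_of_mem_span hsub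
  obtain ⟨C, hC⟩ := hφ.exists_ae_abs_le_of_mem_span hsub
  rw [eLpNorm_le_ofReal_iff hmeas hC (by omega) (by positivity)] at hfg
  rw [eLpNorm_le_ofReal_iff hmeas hC hp ht]
  calc _ ≤ 2 * (2 * T) ^ (2 * p - 1) :=
        integral_pow_two_mul_le hmeas hC hp (by positivity)
          (integral_sub_sq_le_four hφ hf (hcs hg)) hfg
    _ = 2 ^ (2 * p) * T ^ (2 * p - 1) := by
        have : 2 * p = (2 * p - 1) + 1 := by omega
        rw [this, pow_succ (2 : ℝ), mul_pow]
        simp only [Nat.add_sub_cancel]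
        ring
    _ ≤ 2 ^ (2 * p) * (t / 2) ^ (2 * p) := by gcongr
    _ = t ^ (2 * p) := by
        rw [← mul_pow]
        congr 1
        ring

/-! ### Nets in finite-dimensional spaces -/

theorem exists_finset_cover_closedBall_two (E : Type*) [NormedAddCommGroup E] [NormedSpace ℝ E]
    [FiniteDimensional ℝ E] :
    ∃ c : Finset E, (∀ y : E, ‖y‖ ≤ 2 → ∃ z ∈ c, ‖y - z‖ ≤ 1) ∧
      c.card ≤ 5 ^ Module.finrank ℝ E := by
  classical
  by_contra! hcon
  -- Without a small net, separated subsets of the ball could be extended for ever.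
  have key : ∀ j : ℕ, ∃ s : Finset E, (∀ c ∈ s, ‖c‖ ≤ 2) ∧
      (∀ c ∈ s, ∀ d ∈ s, c ≠ d → 1 ≤ ‖c - d‖) ∧ s.card = j := by
    intro j
    induction j with
    | zero => exact ⟨∅, by simp⟩
    | succ j ih =>
      obtain ⟨s, hs, hsep, rfl⟩ := ih
      have hcard := Besicovitch.card_le_of_separated s hs hsep
      have : ∃ y : E, ‖y‖ ≤ 2 ∧ ∀ z ∈ s, 1 < ‖y - z‖ := by
        by_contra! h
        exact absurd hcard (not_le.2 (hcon s h))
      obtain ⟨y, hy, hys⟩ := this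
      have hyn : y ∉ s := fun h => by
        have := hys y h
        rw [sub_self, norm_zero] at this
        linarith
      refine ⟨insert y s, ?_, ?_, Finset.card_insert_of_notMem hyn⟩
      · intro c hc
        rcases Finset.mem_insert.1 hc with rfl | hc
        exacts [hy, hs c hc]
      · intro c hc d hd hcd
        rcases Finset.mem_insert.1 hc with hcy | hcs <;>
          rcases Finset.mem_insert.1 hd with hdy | hds
        · exact absurd (hcy.trans hdy.symm) hcd
        · exact hcy ▸ (hys d hds).le
        · rw [norm_sub_rev]
          exact hdy ▸ (hys c hcs).le
        · exact hsep c hcs d hds hcd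
  obtain ⟨s, hs, hsep, hcard⟩ := key (5 ^ Module.finrank ℝ E + 1)
  have := Besicovitch.card_le_of_separated s hs hsep
  omega

/-- A ball in a space of dimension `d` is covered by `5 ^ d` balls of half the radius; iterated `k`
times. -/
theorem exists_finset_cover_halving (E : Type*) [NormedAddCommGroup E] [NormedSpace ℝ E]
    [FiniteDimensional ℝ E] {R : ℝ} (hR : 0 < R) (k : ℕ) :
    ∃ c : Finset E, (∀ y : E, ‖y‖ ≤ R → ∃ z ∈ c, ‖y - z‖ ≤ R / 2 ^ k) ∧
      c.card ≤ (5 ^ Module.finrank ℝ E) ^ k := by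
  classical
  obtain ⟨c₀, hc₀, hcard₀⟩ := exists_finset_cover_closedBall_two E
  induction k with
  | zero => exact ⟨{0}, fun y hy => ⟨0, by simpa using hy⟩, by simp⟩
  | succ k ih =>
    obtain ⟨c, hc, hcard⟩ := ih
    set r := R / 2 ^ (k + 1) with hr
    have hr0 : 0 < r := by positivity
    have hr2 : R / 2 ^ k = r * 2 := by
      rw [hr]
      field_simp
      ring
    refine ⟨Finset.image₂ (fun z x => z + r • x) c c₀, fun y hy => ?_, ?_⟩
    · obtain ⟨z, hz, hyz⟩ := hc y hy
      obtain ⟨x, hx, hyx⟩ := hc₀ (r⁻¹ • (y - z)) (by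
        rw [norm_smul, norm_inv, Real.norm_of_nonneg hr0.le, inv_mul_le_iff₀ hr0, ← hr2]
        exact hyz)
      refine ⟨z + r • x, Finset.mem_image₂_of_mem hz hx, ?_⟩
      have : y - (z + r • x) = r • (r⁻¹ • (y - z) - x) := by
        rw [smul_sub, smul_inv_smul₀ hr0.ne']
        abel
      rw [this, norm_smul, Real.norm_of_nonneg hr0.le]
      exact mul_le_of_le_one_right hr0.le hyx
    · refine (Finset.card_image₂_le _ _ _).trans ?_
      rw [pow_succ]
      exact Nat.mul_le_mul hcard hcard₀

/-- Nets for the seminorm `‖T ·‖` pulled back along a linear map. -/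
theorem LinearMap.exists_finset_cover_halving {W E : Type*} [AddCommGroup W] [Module ℝ W]
    [FiniteDimensional ℝ W] [NormedAddCommGroup E] [NormedSpace ℝ E] (T : W →ₗ[ℝ] E) {R : ℝ}
    (hR : 0 < R) (k : ℕ) :
    ∃ c : Finset W, (∀ y : W, ‖T y‖ ≤ R → ∃ z ∈ c, ‖T (y - z)‖ ≤ R / 2 ^ k) ∧
      c.card ≤ (5 ^ Module.finrank ℝ W) ^ k := by
  classical
  obtain ⟨c, hc, hcard⟩ := _root_.exists_finset_cover_halving (LinearMap.range T) hR k
  choose F hF using fun z : LinearMap.range T => z.2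
  refine ⟨c.image F, fun y hy => ?_, ?_⟩
  · obtain ⟨z, hz, hzy⟩ := hc (T.rangeRestrict y) hy
    refine ⟨F z, Finset.mem_image_of_mem _ hz, ?_⟩
    rw [map_sub, hF z]
    exact hzy
  · exact Finset.card_image_le.trans (hcard.trans (Nat.pow_le_pow_left
      (Nat.pow_le_pow_right (by norm_num) (LinearMap.finrank_range_le T)) k))

/-- Nets of an `L^q` ball in the span of finitely many functions, obtained through the linear map
from the span to `Lp`; the functions need not be linearly independent. -/
theorem exists_finset_net_span {Ω : Type*} [MeasurableSpace Ω] {μ : Measure Ω} {ι : Type*}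
    [Fintype ι] {q : ℝ≥0∞} (hq : 1 ≤ q) {ψ : ι → Ω → ℝ} (hψ : ∀ i, MemLp (ψ i) q μ) {R : ℝ}
    (hR : 0 < R) (k : ℕ) :
    ∃ D : Finset (Ω → ℝ),
      (D : Set (Ω → ℝ)) ⊆ (Submodule.span ℝ (Set.range ψ) : Submodule ℝ (Ω → ℝ)) ∧
      (∀ h ∈ Submodule.span ℝ (Set.range ψ), eLpNorm h q μ ≤ ENNReal.ofReal R →
        ∃ g ∈ D, eLpNorm (h - g) q μ ≤ ENNReal.ofReal (R / 2 ^ k)) ∧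
      D.card ≤ (5 ^ Fintype.card ι) ^ k := by
  classical
  have : Fact (1 ≤ q) := ⟨hq⟩
  set W : Submodule ℝ (Ω → ℝ) := Submodule.span ℝ (Set.range ψ) with hW
  have hmem : ∀ f ∈ W, MemLp f q μ := by
    intro f hf
    induction hf using Submodule.span_induction with
    | mem f hf =>
      obtain ⟨i, rfl⟩ := hf
      exact hψ i
    | zero => exact MemLp.zero
    | add f g _ _ hf hg => exact hf.add hg
    | smul a f _ hf => exact hf.const_smul a
  obtain ⟨T, hT⟩ : ∃ T : W →ₗ[ℝ] Lp ℝ q μ,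
      ∀ f : W, ‖T f‖ = (eLpNorm (f : Ω → ℝ) q μ).toReal :=
    ⟨{ toFun := fun f => (hmem f f.2).toLp f
       map_add' := fun f g => MemLp.toLp_add (hmem f f.2) (hmem g g.2)
       map_smul' := fun a f => MemLp.toLp_const_smul a (hmem f f.2) },
      fun f => Lp.norm_toLp (f : Ω → ℝ) (hmem f f.2)⟩
  have : FiniteDimensional ℝ W := FiniteDimensional.span_of_finite ℝ (Set.finite_range ψ)
  have hnorm : ∀ (f : W) {s : ℝ}, 0 ≤ s →
      (‖T f‖ ≤ s ↔ eLpNorm (f : Ω → ℝ) q μ ≤ ENNReal.ofReal s) := by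
    intro f s hs
    rw [hT f, ENNReal.le_ofReal_iff_toReal_le (hmem f f.2).eLpNorm_ne_top hs]
  obtain ⟨c, hc, hcard⟩ := T.exists_finset_cover_halving hR k
  refine ⟨c.image (Subtype.val : W → Ω → ℝ), ?_, fun h hh hhR => ?_, ?_⟩
  · intro g hg
    obtain ⟨z, -, rfl⟩ := Finset.mem_image.1 hg
    exact z.2
  · obtain ⟨z, hz, hzh⟩ := hc ⟨h, hh⟩ ((hnorm ⟨h, hh⟩ hR.le).2 hhR)
    have hzh' := (hnorm _ (by positivity)).1 hzh
    rw [Submodule.coe_sub] at hzh'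
    exact ⟨z, Finset.mem_image_of_mem _ hz, hzh'⟩
  · exact Finset.card_image_le.trans (hcard.trans (Nat.pow_le_pow_left
      (Nat.pow_le_pow_right (by norm_num) (finrank_range_le_card ψ)) k))

/-! ### Small radii -/

/-- Refining a cover: for each support `A`, the balls are recentred in the span of `φⱼ`, `j ∈ A`,
and then covered inside this space of dimension at most `m`. -/
theorem HasCover.refine_by_halving {Ω : Type*} [MeasurableSpace Ω] {μ : Measure Ω}
    [IsProbabilityMeasure μ] {n m : ℕ} {φ : Fin n → Ω → ℝ} (hφ : IsBoundedOrthogonalSystem μ φ)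
    {q : ℝ≥0∞} (hq : 1 ≤ q) {R N : ℝ} (hR : 0 < R)
    (h : HasCover μ φ q (sparseUnitSums φ m) R N) (k : ℕ) :
    HasCover μ φ q (sparseUnitSums φ m) (2 * R / 2 ^ k)
      ((n.choose m : ℝ) * (N * ((5 : ℝ) ^ m) ^ k)) := by
  classical
  have hspan := sparseUnitSums_subset_span φ m
  let W : Finset (Fin n) → Submodule ℝ (Ω → ℝ) := fun A =>
    Submodule.span ℝ (Set.range fun j : A => φ j)
  have hWle : ∀ A, W A ≤ Submodule.span ℝ (Set.range φ) := fun A =>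
    Submodule.span_mono (Set.range_comp_subset_range _ φ)
  have hcover : ∀ A : Finset (Fin n), ∃ c : Finset (Ω → ℝ),
      (c : Set (Ω → ℝ)) ⊆ sparseUnitSums φ m ∩ W A ∧
      (∀ f ∈ sparseUnitSums φ m ∩ W A, ∃ g ∈ c,
        eLpNorm (f - g) q μ ≤ ENNReal.ofReal (2 * R)) ∧ (c.card : ℝ) ≤ N := fun A =>
    h.exists_centers_mem hφ hq hR.le hspan Set.inter_subset_left
  have hmemLp : ∀ j, MemLp (φ j) q μ := fun j =>
    MemLp.of_bound (hφ.aestronglyMeasurable j) 1 (hφ.ae_abs_le_one.mono fun _ hu => hu j)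
  have hnet := fun A : Finset (Fin n) => exists_finset_net_span hq
    (ψ := fun j : A => φ j) (fun j => hmemLp j) (R := 2 * R) (by positivity) k
  choose c hc hcov hccard using hcover
  choose D hD hDcov hDcard using hnet
  refine ⟨(Finset.powersetCard m Finset.univ).biUnion fun A =>
    Finset.image₂ (fun g d => g + d) (c A) (D A), ?_, fun f hf => ?_, ?_⟩
  · intro g hg
    obtain ⟨A, -, hg⟩ := Finset.mem_biUnion.1 hg
    obtain ⟨g', hg', d, hd, rfl⟩ := Finset.mem_image₂.1 hg
    exact Submodule.add_mem _ (hspan (hc A hg').1) (hWle A (hD A hd))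
  · obtain ⟨A, hA, b, hb, -, hfb⟩ := mem_sparseUnitSums_iff.1 hf
    have hfW : f ∈ W A := by
      rw [hfb]
      refine Submodule.sum_mem _ fun j _ => ?_
      by_cases hj : j ∈ A
      · exact Submodule.smul_mem _ _ (Submodule.subset_span ⟨⟨j, hj⟩, rfl⟩)
      · rw [hb j hj, zero_smul]
        exact Submodule.zero_mem _
    obtain ⟨g, hg, hfg⟩ := hcov A f ⟨hf, hfW⟩
    obtain ⟨d, hd, hfd⟩ := hDcov A (f - g) (Submodule.sub_mem _ hfW (hc A hg).2) hfg
    refine ⟨g + d, Finset.mem_biUnion.2 ⟨A, ?_, Finset.mem_image₂_of_mem hg hd⟩, ?_⟩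
    · exact Finset.mem_powersetCard.2 ⟨Finset.subset_univ A, hA⟩
    · rwa [← sub_sub]
  · have hle : ∀ A ∈ Finset.powersetCard m (Finset.univ : Finset (Fin n)),
        ((Finset.image₂ (fun g d => g + d) (c A) (D A)).card : ℝ) ≤ N * ((5 : ℝ) ^ m) ^ k := by
      intro A hA
      have h1 : ((Finset.image₂ (fun g d => g + d) (c A) (D A)).card : ℝ) ≤
          (c A).card * (D A).card := by
        exact_mod_cast Finset.card_image₂_le _ _ _
      have h2 : ((D A).card : ℝ) ≤ ((5 : ℝ) ^ m) ^ k := by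
        have := hDcard A
        rw [Fintype.card_coe, (Finset.mem_powersetCard.1 hA).2] at this
        exact_mod_cast this
      exact h1.trans (mul_le_mul (hccard A) h2 (Nat.cast_nonneg _)
        ((Nat.cast_nonneg _).trans (hccard A)))
    calc _ ≤ ∑ A ∈ Finset.powersetCard m (Finset.univ : Finset (Fin n)),
          ((Finset.image₂ (fun g d => g + d) (c A) (D A)).card : ℝ) := by
          exact_mod_cast Finset.card_biUnion_le
      _ ≤ ∑ _A ∈ Finset.powersetCard m (Finset.univ : Finset (Fin n)), N * ((5 : ℝ) ^ m) ^ k :=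
          Finset.sum_le_sum hle
      _ = _ := by
          rw [Finset.sum_const, Finset.card_powersetCard, Finset.card_univ, Fintype.card_fin,
            nsmul_eq_mul]

theorem choose_le_exp_log {n m : ℕ} (hm : 1 ≤ m) (hmn : m ≤ n) :
    (n.choose m : ℝ) ≤ Real.exp (3 * (m * Real.log (1 + (n : ℝ) / m))) := by
  have hm0 : (0 : ℝ) < m := by exact_mod_cast hm
  have hn0 : (0 : ℝ) < n := by exact_mod_cast hm.trans hmn
  have hL := log_one_add_div_ge hm hmn
  have hlog : Real.log ((n : ℝ) / m) ≤ Real.log (1 + (n : ℝ) / m) :=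
    Real.log_le_log (by positivity) (by linarith)
  calc (n.choose m : ℝ) ≤ (Real.exp 1 * (n / m)) ^ m := choose_le_exp_mul_div_pow hm le_rfl
    _ = Real.exp (m * (1 + Real.log (n / m))) := by
        rw [Real.exp_nat_mul, Real.exp_add, Real.exp_log (by positivity)]
    _ ≤ _ := by
        refine Real.exp_le_exp.2 ?_
        rw [mul_left_comm]
        exact mul_le_mul_of_nonneg_left (by linarith) hm0.le

/-- The entropy bound `m log (1 + 1 / t) log (1 + n / m)` in `L^{2p}` for radii below `8`. -/
theorem hasCover_of_lt_eight {Ω : Type*} [MeasurableSpace Ω] {μ : Measure Ω}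
    [IsProbabilityMeasure μ] {n m : ℕ} {φ : Fin n → Ω → ℝ} (hφ : IsBoundedOrthogonalSystem μ φ)
    (hm : 1 ≤ m) (hmn : m ≤ n) {p : ℕ} (hp : 1 ≤ p) {t : ℝ} (ht : 0 < t) (ht8 : t < 8) :
    HasCover μ φ ((2 * p : ℕ) : ℝ≥0∞) (sparseUnitSums φ m) t
      (Real.exp ((300 + 9 * (momentConst p + 1)) *
        ((m : ℝ) * Real.log (1 + 1 / t) * Real.log (1 + (n : ℝ) / m)))) := by
  have hm0 : (0 : ℝ) < m := by exact_mod_cast hm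
  have hK := one_le_momentConst p
  have hL := log_one_add_div_ge hm hmn
  set L := Real.log (1 + (n : ℝ) / m) with hLdef
  set l := Real.log (1 + 1 / t) with hldef
  have hx : 1 / 8 < 1 / t := one_div_lt_one_div_of_lt ht ht8
  have hl : 1 / 9 ≤ l := by
    have h1 := Real.one_sub_inv_le_log_of_pos (show (0 : ℝ) < 9 / 8 by norm_num)
    have h2 : Real.log (9 / 8) ≤ l := Real.log_le_log (by norm_num) (by linarith)
    norm_num at h1
    linarith
  have h2lo := Real.log_two_gt_d9
  have h2hi := Real.log_two_lt_d9
  -- The number of halvings that lead from radius `16` to radius `t`.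
  set k := ⌈Real.log (16 / t) / Real.log 2⌉₊ with hk
  have hkt : 2 * 8 / 2 ^ k ≤ t := by
    have h1 : Real.log (16 / t) ≤ k * Real.log 2 := by
      rw [← div_le_iff₀ (by linarith)]
      exact Nat.le_ceil _
    rw [← Real.log_pow] at h1
    have h2 := (Real.log_le_log_iff (by positivity) (by positivity)).1 h1
    rw [div_le_iff₀ (by positivity)]
    rw [div_le_iff₀ ht] at h2
    linarith
  have hkl : (k : ℝ) ≤ 62 * l := by
    have h16 : Real.log (16 / t) ≤ 26.2 * l := by
      have h1 : Real.log (16 / t) = 4 * Real.log 2 + Real.log (1 / t) := by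
        rw [div_eq_mul_one_div, Real.log_mul (by norm_num) (by positivity),
          show (16 : ℝ) = 2 ^ 4 by norm_num, Real.log_pow]
        norm_num
      have h2 : Real.log (1 / t) ≤ l := Real.log_le_log (by positivity) (by linarith)
      linarith
    have h0 : 0 ≤ Real.log (16 / t) := by
      refine Real.log_nonneg ?_
      rw [le_div_iff₀ ht]
      linarith
    have h3 : Real.log (16 / t) / Real.log 2 ≤ 52.4 * l := by
      rw [div_le_iff₀ (by linarith)]
      nlinarith
    have h4 : (k : ℝ) ≤ Real.log (16 / t) / Real.log 2 + 1 :=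
      (Nat.ceil_lt_add_one (div_nonneg h0 (by linarith))).le
    linarith
  have h5 : ((5 : ℝ) ^ m) ^ k ≤ Real.exp (248 * (m * l * L)) := by
    have h5e : (5 : ℝ) ≤ Real.exp 2 := by
      have h1 : Real.exp 2 = Real.exp 1 * Real.exp 1 := by
        rw [← Real.exp_add]
        norm_num
      have h2 := Real.exp_one_gt_d9
      nlinarith
    calc ((5 : ℝ) ^ m) ^ k ≤ ((Real.exp 2) ^ m) ^ k := by gcongr
      _ = Real.exp (k * (m * 2)) := by rw [Real.exp_nat_mul, Real.exp_nat_mul]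
      _ ≤ _ := by
        refine Real.exp_le_exp.2 ?_
        calc (k : ℝ) * (m * 2) ≤ 62 * l * (m * 2) := by gcongr
          _ = 248 * (m * l * (1 / 2)) := by ring
          _ ≤ 248 * (m * l * L) := by gcongr
  have hcover8 : HasCover μ φ ((2 * p : ℕ) : ℝ≥0∞) (sparseUnitSums φ m) 8
      (Real.exp (9 * (momentConst p + 1) * (m * l * L))) := by
    refine (hasCover_of_two_lt hφ hm hmn hp (by norm_num)).mono_card (Real.exp_le_exp.2 ?_)
    have h8 : Real.log 8 ≤ 2.1 := by
      rw [show (8 : ℝ) = 2 ^ 3 by norm_num, Real.log_pow]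
      norm_num
      linarith
    have hz : (8 : ℝ) ^ (-2 : ℤ) = 1 / 64 := by norm_num
    rw [hz]
    calc 14 * (momentConst p + 1) * (m * (1 / 64) * Real.log 8 * L)
        ≤ 14 * (momentConst p + 1) * (m * (1 / 64) * 2.1 * L) := by gcongr
      _ = 14 * 2.1 / 64 * ((momentConst p + 1) * (m * 1 * L)) := by ring
      _ ≤ 1 * ((momentConst p + 1) * (m * (9 * l) * L)) := by
          gcongr
          · norm_num
          · linarith
      _ = _ := by ring
  have hchoose : (n.choose m : ℝ) ≤ Real.exp (27 * (m * l * L)) := by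
    refine (choose_le_exp_log hm hmn).trans (Real.exp_le_exp.2 ?_)
    calc 3 * (m * L) = 27 * (m * (1 / 9) * L) := by ring
      _ ≤ 27 * (m * l * L) := by gcongr
  have hq1 : (1 : ℝ≥0∞) ≤ ((2 * p : ℕ) : ℝ≥0∞) := by
    rw [Nat.one_le_cast]
    omega
  obtain ⟨c, hcs, hc, hcard⟩ := hcover8.refine_by_halving hφ hq1 (by norm_num) k
  refine ⟨c, hcs, fun f hf => ?_, hcard.trans ?_⟩
  · obtain ⟨g, hg, hfg⟩ := hc f hf
    exact ⟨g, hg, hfg.trans (ENNReal.ofReal_le_ofReal hkt)⟩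
  · calc _ ≤ Real.exp (27 * (m * l * L)) *
          (Real.exp (9 * (momentConst p + 1) * (m * l * L)) * Real.exp (248 * (m * l * L))) := by
          gcongr
      _ ≤ _ := by
          rw [← Real.exp_add, ← Real.exp_add]
          refine Real.exp_le_exp.2 ?_
          have : 0 ≤ m * l * L := by positivity
          linarith

/-! ### Large radii -/

/-- The entropy bound `m t^(-ν) log (1 + n / m)` in `L^{2p}` with `ν = 2 + 1 / (2p - 1)`.
It follows from the bound in `L^{4p-2}` at the radius `T = (t / 2) ^ (1 + 1 / (2p - 1))`, where
`T⁻² = (t / 2) ^ (-2 - 2 / (2p - 1))`; half of the gain `2 / (2p - 1)` absorbs `log T`. -/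
theorem hasCover_of_eight_le {Ω : Type*} [MeasurableSpace Ω] {μ : Measure Ω}
    [IsProbabilityMeasure μ] {n m : ℕ} {φ : Fin n → Ω → ℝ} (hφ : IsBoundedOrthogonalSystem μ φ)
    (hm : 1 ≤ m) (hmn : m ≤ n) {p : ℕ} (hp : 1 ≤ p) {t : ℝ} (ht : 8 ≤ t) :
    HasCover μ φ ((2 * p : ℕ) : ℝ≥0∞) (sparseUnitSums φ m) t
      (Real.exp (14 * (momentConst (2 * p - 1) + 1) * (2 * p) *
        2 ^ (2 + ((2 * p - 1 : ℕ) : ℝ)⁻¹) *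
        ((m : ℝ) * t ^ (-(2 + ((2 * p - 1 : ℕ) : ℝ)⁻¹)) * Real.log (1 + (n : ℝ) / m)))) := by
  have hL := log_one_add_div_ge hm hmn
  have hN : 1 ≤ 2 * p - 1 := by omega
  have hpN : ((2 * p : ℕ) : ℝ) = ((2 * p - 1 : ℕ) : ℝ) + 1 := by
    have : 2 * p = (2 * p - 1) + 1 := by omega
    exact_mod_cast this
  have hK := one_le_momentConst (2 * p - 1)
  have hp2 : (2 * p : ℝ) = ((2 * p - 1 : ℕ) : ℝ) + 1 := by
    rw [← hpN]
    push_cast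
    ring
  have hN0 : (0 : ℝ) < ((2 * p - 1 : ℕ) : ℝ) := by exact_mod_cast hN
  set δ : ℝ := ((2 * p - 1 : ℕ) : ℝ)⁻¹ with hδ
  have hδ0 : 0 < δ := inv_pos.2 hN0
  set x := t / 2 with hx
  have hx4 : 4 ≤ x := by linarith
  have hx0 : 0 < x := by linarith
  set T := x ^ (1 + δ) with hT
  have hxT : x ≤ T := by
    have := Real.rpow_le_rpow_of_exponent_le (by linarith : 1 ≤ x) (by linarith : 1 ≤ 1 + δ)
    rwa [Real.rpow_one] at this
  have hTpow : T ^ (2 * p - 1) ≤ (t / 2) ^ (2 * p) := by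
    refine le_of_eq ?_
    rw [hT, ← Real.rpow_natCast, ← Real.rpow_mul hx0.le, ← Real.rpow_natCast, ← hx, hpN]
    congr 1
    rw [hδ]
    field_simp
  refine ((hasCover_of_two_lt hφ hm hmn hN (by linarith)).of_interpolation hφ hp (by linarith)
    (by linarith) hTpow).mono_card (Real.exp_le_exp.2 ?_)
  have hlogx : Real.log x ≤ x ^ δ / δ := Real.log_le_rpow_div hx0.le hδ0
  have hgain : T ^ (-2 : ℤ) * Real.log T ≤ (2 * p) * (2 ^ (2 + δ) * t ^ (-(2 + δ))) := by
    have h1 : T ^ (-2 : ℤ) = x ^ (-(2 + 2 * δ)) := by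
      rw [← Real.rpow_intCast, hT, ← Real.rpow_mul hx0.le]
      congr 1
      push_cast
      ring
    have h2 : Real.log T = (1 + δ) * Real.log x := Real.log_rpow hx0 _
    have h3 : x ^ (-(2 + δ)) = 2 ^ (2 + δ) * t ^ (-(2 + δ)) := by
      rw [hx, Real.div_rpow (by linarith) (by norm_num), Real.rpow_neg (by norm_num : (0 : ℝ) ≤ 2),
        div_inv_eq_mul, mul_comm]
    have h4 : (1 + δ) / δ = 2 * p := by
      rw [hp2, hδ]
      field_simp
    rw [h1, h2, ← h3, ← h4]
    calc x ^ (-(2 + 2 * δ)) * ((1 + δ) * Real.log x)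
        ≤ x ^ (-(2 + 2 * δ)) * ((1 + δ) * (x ^ δ / δ)) := by gcongr
      _ = (1 + δ) / δ * (x ^ (-(2 + 2 * δ)) * x ^ δ) := by ring
      _ = (1 + δ) / δ * x ^ (-(2 + δ)) := by
          rw [← Real.rpow_add hx0]
          congr 2
          ring
  have hc : 0 ≤ 14 * (momentConst (2 * p - 1) + 1) * (m * Real.log (1 + (n : ℝ) / m)) := by
    positivity
  have := mul_le_mul_of_nonneg_left hgain hc
  calc _ = 14 * (momentConst (2 * p - 1) + 1) * (m * Real.log (1 + (n : ℝ) / m)) *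
        (T ^ (-2 : ℤ) * Real.log T) := by ring
    _ ≤ _ := this
    _ = _ := by ring

theorem exists_le_two_mul_natCast {q : ℝ≥0∞} (hq : q ≠ ∞) :
    ∃ p : ℕ, 1 ≤ p ∧ q ≤ ((2 * p : ℕ) : ℝ≥0∞) := by
  obtain ⟨N, hN⟩ := ENNReal.exists_nat_gt hq
  refine ⟨N + 1, by omega, hN.le.trans ?_⟩
  exact_mod_cast (by omega : N ≤ 2 * (N + 1))

theorem theorem5 :
    (∀ q : ℝ≥0∞, 2 ≤ q → q ≠ ∞ →
      ∃ ν : ℝ, 2 < ν ∧ ∃ C : ℝ, 0 < C ∧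
        ∀ (Ω : Type u) [MeasurableSpace Ω] (μ : Measure Ω) [IsProbabilityMeasure μ]
          (n m : ℕ) (φ : Fin n → Ω → ℝ),
          IsBoundedOrthogonalSystem μ φ → 1 ≤ m → m ≤ n →
          (∀ t : ℝ, 8 ≤ t →
            entropyNumber μ φ q (sparseUnitSums φ m) t ≠ ⊤ ∧
            Real.log ((entropyNumber μ φ q (sparseUnitSums φ m) t).toNat : ℝ) ≤
              C * ((m : ℝ) * t ^ (-ν) * Real.log (1 + (n : ℝ) / (m : ℝ)))) ∧
          (∀ t : ℝ, 0 < t → t < 8 →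
            entropyNumber μ φ q (sparseUnitSums φ m) t ≠ ⊤ ∧
            Real.log ((entropyNumber μ φ q (sparseUnitSums φ m) t).toNat : ℝ) ≤
              C * ((m : ℝ) * Real.log (1 + 1 / t) * Real.log (1 + (n : ℝ) / (m : ℝ))))) ∧
    (∀ r : ℝ≥0∞, 2 ≤ r → r ≠ ∞ →
      ∃ C : ℝ, 0 < C ∧
        ∀ (Ω : Type u) [MeasurableSpace Ω] (μ : Measure Ω) [IsProbabilityMeasure μ]
          (n m : ℕ) (φ : Fin n → Ω → ℝ),
          IsBoundedOrthogonalSystem μ φ → 1 ≤ m → m ≤ n →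
          ∀ t : ℝ, 2 < t →
            entropyNumber μ φ r (sparseUnitSums φ m) t ≠ ⊤ ∧
            Real.log ((entropyNumber μ φ r (sparseUnitSums φ m) t).toNat : ℝ) ≤
              C * ((m : ℝ) * t ^ (-2 : ℤ) * Real.log t *
                Real.log (1 + (n : ℝ) / (m : ℝ)))) := by
  constructor
  · intro q _ hq
    obtain ⟨p, hp, hqp⟩ := exists_le_two_mul_natCast hq
    have hN0 : (0 : ℝ) < ((2 * p - 1 : ℕ) : ℝ) := by
      have : 1 ≤ 2 * p - 1 := by omega
      exact_mod_cast this
    have hp0 : (0 : ℝ) < p := by exact_mod_cast hp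
    have hK := one_le_momentConst p
    have hK' := one_le_momentConst (2 * p - 1)
    set ν : ℝ := 2 + ((2 * p - 1 : ℕ) : ℝ)⁻¹ with hν
    set C₁ : ℝ := 14 * (momentConst (2 * p - 1) + 1) * (2 * p) * 2 ^ ν with hC₁
    set C₂ : ℝ := 300 + 9 * (momentConst p + 1) with hC₂
    have hC₁0 : 0 < C₁ := by positivity
    have hC₂0 : 0 < C₂ := by positivity
    refine ⟨ν, by rw [hν]; linarith [inv_pos.2 hN0], C₁ + C₂, by positivity, ?_⟩
    intro Ω _ μ _ n m φ hφ hm hmn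
    have hspan := sparseUnitSums_subset_span φ m
    have hL := log_one_add_div_ge hm hmn
    refine ⟨fun t ht => ?_, fun t ht ht8 => ?_⟩
    · have h0 : 0 ≤ (m : ℝ) * t ^ (-ν) * Real.log (1 + (n : ℝ) / (m : ℝ)) := by
        have : 0 ≤ t ^ (-ν) := Real.rpow_nonneg (by linarith) _
        positivity
      refine HasCover.entropyNumber_ne_top_and_log_le
        (((hasCover_of_eight_le hφ hm hmn hp ht).mono_exponent hφ hspan hqp).mono_card
          (Real.exp_le_exp.2 (mul_le_mul_of_nonneg_right ?_ h0)))
        (mul_nonneg (by positivity) h0)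
      exact le_add_of_nonneg_right hC₂0.le
    · have h0 : 0 ≤ (m : ℝ) * Real.log (1 + 1 / t) * Real.log (1 + (n : ℝ) / (m : ℝ)) := by
        have h1 : 0 < 1 / t := by positivity
        have : 0 ≤ Real.log (1 + 1 / t) := Real.log_nonneg (by linarith)
        positivity
      refine HasCover.entropyNumber_ne_top_and_log_le
        (((hasCover_of_lt_eight hφ hm hmn hp ht ht8).mono_exponent hφ hspan hqp).mono_card
          (Real.exp_le_exp.2 (mul_le_mul_of_nonneg_right ?_ h0)))
        (mul_nonneg (by positivity) h0)
      exact le_add_of_nonneg_left hC₁0.le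
  · intro r _ hr
    obtain ⟨p, hp, hrp⟩ := exists_le_two_mul_natCast hr
    have hK := one_le_momentConst p
    refine ⟨14 * (momentConst p + 1), by positivity, ?_⟩
    intro Ω _ μ _ n m φ hφ hm hmn t ht
    have hL := log_one_add_div_ge hm hmn
    refine HasCover.entropyNumber_ne_top_and_log_le
      ((hasCover_of_two_lt hφ hm hmn hp ht).mono_exponent hφ (sparseUnitSums_subset_span φ m) hrp)
      ?_
    have : 0 ≤ Real.log t := Real.log_nonneg (by linarith)
    positivity
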